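/- Conventions: $\mathbb{N}=\{0,1,2,\dots\}$ and each $n\in\mathbb{N}$ is identified with the ordinal $\{0,\dots,n-1\}$; $\omega$ is the first infinite ordinal. For well-ordered sets $A,B$, a surjection $f:A\to B$ is a *rigid surjection* if $\min f^{-1}(b)<\min f^{-1}(b')$ whenever $b<b'$ in $B$; $\mathrm{RSurj}(A,B)$ denotes the set of all rigid surjections $A\to B$. For $s\in\mathbb{N}$ let $\pi_{s+1}\in\mathrm{RSurj}(\omega,s+1)$ be given by $\pi_{s+1}(j)=j$ for $j<s+1$ and $\pi_{s+1}(j)=s$ for $j\ge s+1$. For $u\in\mathrm{RSurj}(\omega,s+1)$ let $\phi_s(u)=u{\restriction}d$ with $d=\min u^{-1}(s)$; this is a rigid surjection from $d$ onto $s$. For $h\in\mathrm{RSurj}(\omega,\omega)$ and $f\in\mathrm{RSurj}(s,r)$ with $s\ge r$, put $$h\circledast f = f\circ\phi_s(\pi_{s+1}\circ h)\in\bigcup_{r\le n<\omega}\mathrm{RSurj}(n,r),$$ and write $h\circledast\mathrm{RSurj}(s,r)=\{h\circledast f: f\in\mathrm{RSurj}(s,r)\}$. Theorem. Let $r,k\in\mathbb{N}$.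 For every coloring $\chi:\bigcup_{r\le s<\omega}\mathrm{RSurj}(s,r)\to k$ there is an $h\in\mathrm{RSurj}(\omega,\omega)$ such that $$\Big|\chi\Big(\bigcup_{r\le s<\omega}h\circledast\mathrm{RSurj}(s,r)\Big)\Big|=1 .$$ -/

import Mathlib

namespace DualRamsey

/-- For a surjection `f : A → B` from a well-ordered set, `firstPreimage f hf b` is `min f⁻¹(b)`. -/
noncomputable def firstPreimage {A B : Type*} [LinearOrder A] [WellFoundedLT A]
    (f : A → B) (hf : Function.Surjective f) (b : B) : A :=
  (wellFounded_lt : WellFounded ((· < ·) : A → A → Prop)).min (f ⁻¹' {b}) (hf b)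

theorem apply_firstPreimage {A B : Type*} [LinearOrder A] [WellFoundedLT A]
    (f : A → B) (hf : Function.Surjective f) (b : B) : f (firstPreimage f hf b) = b :=
  (wellFounded_lt : WellFounded ((· < ·) : A → A → Prop)).min_mem (f ⁻¹' {b}) (hf b)

theorem firstPreimage_le {A B : Type*} [LinearOrder A] [WellFoundedLT A]
    (f : A → B) (hf : Function.Surjective f) (a : A) : firstPreimage f hf (f a) ≤ a :=
  not_lt.mp ((wellFounded_lt : WellFounded ((· < ·) : A → A → Prop)).not_lt_min
    (f ⁻¹' {f a}) (by rfl))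

/-- Rigid surjections `A → B` between well-ordered sets:
surjections `f` such that `min f⁻¹(b) < min f⁻¹(b')` whenever `b < b'`.
The ordinal `ω` is `ℕ` and the finite ordinal `n` is `Fin n`. -/
structure RSurj (A B : Type*) [LinearOrder A] [WellFoundedLT A]
    [LinearOrder B] [WellFoundedLT B] where
  toFun : A → B
  surjective : Function.Surjective toFun
  rigid : ∀ b b' : B, b < b' →
    firstPreimage toFun surjective b < firstPreimage toFun surjective b'

namespace RSurj

section

variable {A B C : Type*} [LinearOrder A] [WellFoundedLT A] [LinearOrder B] [WellFoundedLT B]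
  [LinearOrder C] [WellFoundedLT C]

/-- `f.first b = min f⁻¹(b)`. -/
noncomputable def first (f : RSurj A B) (b : B) : A :=
  firstPreimage f.toFun f.surjective b

theorem apply_first (f : RSurj A B) (b : B) : f.toFun (f.first b) = b :=
  apply_firstPreimage _ _ _

theorem first_le (f : RSurj A B) (a : A) : f.first (f.toFun a) ≤ a :=
  firstPreimage_le _ _ _

theorem first_lt_first (f : RSurj A B) {b b' : B} (h : b < b') : f.first b < f.first b' :=
  f.rigid b b' h

/-- The composition `g ∘ f` of rigid surjections. -/
def comp (g : RSurj B C) (f : RSurj A B) : RSurj A C where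
  toFun := g.toFun ∘ f.toFun
  surjective := g.surjective.comp f.surjective
  rigid := by
    intro c c' hc
    have hs := g.surjective.comp f.surjective
    set a' := firstPreimage (g.toFun ∘ f.toFun) hs c' with ha'
    have h1 : firstPreimage (g.toFun ∘ f.toFun) hs c ≤ f.first (g.first c) := by
      have h := firstPreimage_le (g.toFun ∘ f.toFun) hs (f.first (g.first c))
      simpa only [Function.comp_apply, apply_first] using h
    have h2 : g.toFun (f.toFun a') = c' := apply_firstPreimage (g.toFun ∘ f.toFun) hs c'
    have h3 : g.first c' ≤ f.toFun a' := by
      have h := g.first_le (f.toFun a')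
      rwa [h2] at h
    exact h1.trans_lt
      ((f.first_lt_first ((g.first_lt_first hc).trans_le h3)).trans_le (f.first_le a'))

end

theorem le_of_fin {s r : ℕ} (f : RSurj (Fin s) (Fin r)) : r ≤ s := by
  simpa using Fintype.card_le_of_surjective f.toFun f.surjective

end RSurj

/-- The disjoint union `⋃_{r ≤ s < ω} RSurj(s, r)`. -/
def FinRSurj (r : ℕ) : Type :=
  Σ s : {s : ℕ // r ≤ s}, RSurj (Fin s.1) (Fin r)

/-- The canonical rigid surjection `π_{s+1} : ω → s + 1`,
with `π_{s+1}(j) = j` for `j < s + 1` and `π_{s+1}(j) = s` for `j ≥ s + 1`. -/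
def canonical (s : ℕ) : RSurj ℕ (Fin (s + 1)) where
  toFun j := if h : j < s + 1 then ⟨j, h⟩ else Fin.last s
  surjective b := ⟨b.1, dif_pos b.isLt⟩
  rigid := by
    intro b b' hb
    generalize_proofs hs
    have h1 := firstPreimage_le _ hs b.1
    have h2 := apply_firstPreimage _ hs b'
    simp only [b.isLt, dite_true, Fin.eta] at h1
    refine h1.trans_lt ?_
    split_ifs at h2 with h
    · rw [Fin.ext_iff] at h2
      simp only at h2
      rw [h2]
      exact hb
    · have := b.isLt
      omega

theorem lt_of_lt_first {r : ℕ} (f : RSurj ℕ (Fin (r + 1))) {j : ℕ}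
    (hj : j < f.first (Fin.last r)) : (f.toFun j).1 < r := by
  have h : f.toFun j ≠ Fin.last r := by
    intro h
    have := f.first_le j
    rw [h] at this
    omega
  exact Fin.val_lt_last h

theorem first_castSucc_lt {r : ℕ} (f : RSurj ℕ (Fin (r + 1))) (b : Fin r) :
    f.first b.castSucc < f.first (Fin.last r) :=
  f.first_lt_first (Fin.castSucc_lt_last b)

/-- The restriction of `f ∈ RSurj(ω, r + 1)` to `d = min f⁻¹(r)`, as an element of
`RSurj(d, r)`. -/
def truncate {r : ℕ} (f : RSurj ℕ (Fin (r + 1))) :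
    RSurj (Fin (f.first (Fin.last r))) (Fin r) where
  toFun j := ⟨(f.toFun j.1).1, lt_of_lt_first f j.2⟩
  surjective b := ⟨⟨f.first b.castSucc, first_castSucc_lt f b⟩, by
    simp [RSurj.apply_first]⟩
  rigid := by
    intro b b' hb
    generalize_proofs _ _ _ hs
    have h1 := firstPreimage_le _ hs ⟨f.first b.castSucc, first_castSucc_lt f b⟩
    simp only [RSurj.apply_first, Fin.val_castSucc, Fin.eta] at h1
    refine h1.trans_lt ?_
    have h2 := apply_firstPreimage _ hs b'
    set a := firstPreimage _ hs b'
    have h3 : f.toFun a.1 = b'.castSucc := by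
      rw [Fin.ext_iff] at h2 ⊢
      simpa using h2
    have h4 := f.first_le a.1
    rw [h3] at h4
    have h5 := f.first_lt_first (Fin.castSucc_lt_castSucc_iff.mpr hb)
    exact Fin.lt_def.mpr (h5.trans_le h4)

/-- The map `φ_r : RSurj(ω, r + 1) → ⋃_{r ≤ s < ω} RSurj(s, r)`,
`φ_r(f) = f ↾ d` with `d = min f⁻¹(r)`. -/
noncomputable def phi (r : ℕ) (f : RSurj ℕ (Fin (r + 1))) : FinRSurj r :=
  ⟨⟨f.first (Fin.last r), (truncate f).le_of_fin⟩, truncate f⟩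

/-- The partial composition `h ⊛ f = f ∘ φ_s(π_{s+1} ∘ h)` for `h ∈ RSurj(ω, ω)` and
`f ∈ RSurj(s, r)`. -/
noncomputable def ostar {s r : ℕ} (h : RSurj ℕ ℕ) (f : RSurj (Fin s) (Fin r)) : FinRSurj r :=
  ⟨⟨(phi s ((canonical s).comp h)).1.1, f.le_of_fin.trans (phi s ((canonical s).comp h)).1.2⟩,
    f.comp (phi s ((canonical s).comp h)).2⟩

end DualRamsey

/-! A rigid surjection onto `r + 1` is a word `p ⌢ r ⌢ u` with `p` rigid onto `r` and all letters of
`u` at most `r`. In these terms `h ⊛ f` is a substitution (`subst`) governed by the restrictions `H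
n` of `h` to `min h⁻¹(n)`, and substitutions compose associatively. The proof is by induction on
`r`: once a substitution makes the color depend on `p` alone (`exists_prefixSeq_dependsOn`), the
induction hypothesis applies to the induced coloring of the words `p`.

To remove the dependence on `u` for all `p` of one length `m`, note that every letter of `u` already
occurs in `p ⌢ r`, so `u` can be coded by positions, over an alphabet of size `m + 1`. Coloring
codes by the vector of colors over all `p`, the Carlson–Simpson lemma yields words that serve as the
blocks of the required substitution. A diagonal fusion then handles all `m`.

The Carlson–Simpson lemma comes from an idempotent ultrafilter `q` on left variable words whose
instances `σ a q` all lie in one minimal closed left ideal. There they are right identities, `l * σ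
a q = l`, so an `l`-large set can be extended inside itself again and again. -/

namespace DualRamsey

/-! ### Ultrafilters and the Carlson–Simpson lemma -/

section LeftVariableWords

open Filter

attribute [local instance] Ultrafilter.mul Ultrafilter.semigroup

/-- In a compact right topological semigroup there is a closed left ideal all of whose idempotents
are right identities on it. -/
theorem exists_closed_leftIdeal_mul_idempotent {M : Type*} [Nonempty M] [Semigroup M]
    [TopologicalSpace M] [CompactSpace M] [T2Space M] (hM : ∀ r : M, Continuous (· * r)) :
    ∃ L : Set M, IsClosed L ∧ L.Nonempty ∧ (∀ x, ∀ l ∈ L, x * l ∈ L) ∧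
      ∀ e ∈ L, e * e = e → ∀ p ∈ L, p * e = p := by
  let S : Set (Set M) := { N | IsClosed N ∧ N.Nonempty ∧ ∀ x, ∀ l ∈ N, x * l ∈ N }
  obtain ⟨L, hL⟩ : ∃ L, Minimal (· ∈ S) L := by
    refine zorn_superset S fun c hcs hc => ?_
    refine ⟨⋂₀ c, ⟨isClosed_sInter fun t ht => (hcs ht).1, ?_, fun x l hl t ht =>
      (hcs ht).2.2 x l (hl t ht)⟩, fun s hs => Set.sInter_subset_of_mem hs⟩
    obtain rfl | hcn := c.eq_empty_or_nonempty
    · rw [Set.sInter_empty]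
      exact Set.univ_nonempty
    · have := hcn.to_subtype
      rw [Set.sInter_eq_iInter]
      exact IsCompact.nonempty_iInter_of_directed_nonempty_isCompact_isClosed _
        (DirectedOn.directed_val (IsChain.directedOn hc.symm)) (fun i => (hcs i.2).2.1)
        (fun i => (hcs i.2).1.isCompact) (fun i => (hcs i.2).1)
  refine ⟨L, hL.prop.1, hL.prop.2.1, hL.prop.2.2, fun e he hee p hp => ?_⟩
  -- `L * e` is a closed left ideal inside `L`, so minimality gives equality and every `p ∈ L` has
  -- the form `u * e`.
  have h : Set.range (· * e) = L := by
    apply hL.eq_of_subset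
    · refine ⟨(isCompact_range (hM e)).isClosed, Set.range_nonempty _, ?_⟩
      rintro x _ ⟨y, rfl⟩
      exact ⟨x * y, mul_assoc _ _ _⟩
    · rintro _ ⟨y, rfl⟩
      exact hL.prop.2.2 y e he
  rw [← h] at hp
  obtain ⟨u, rfl⟩ := hp
  simp only [mul_assoc, hee]

theorem continuous_ultrafilter_map {α β : Type*} (f : α → β) :
    Continuous (Ultrafilter.map f) :=
  ultrafilterBasis_is_basis.continuous_iff.2 <| Set.forall_mem_range.mpr fun s =>
    ultrafilter_isOpen_basic (f ⁻¹' s)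

theorem ultrafilter_map_mul {M N : Type*} [Mul M] [Mul N] (f : M →ₙ* N) (U V : Ultrafilter M) :
    (U * V).map f = U.map f * V.map f :=
  Ultrafilter.coe_inj.mp <| Filter.ext' fun p => by
    simp [Ultrafilter.eventually_mul, Filter.eventually_map]

/-- The words obtained from `w` by appending `x ⌢ y 0, …, x ⌢ y (n - 1)`, where the variable
`x = none` is replaced by letters of the alphabet `A`. -/
def wordExtensions {A : Type*} (w : FreeMonoid A) (y : ℕ → FreeMonoid (Option A)) :
    ℕ → Set (FreeMonoid A)
  | 0 => {w}
  | n + 1 => {v | ∃ u ∈ wordExtensions w y n, ∃ a : A,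
      v = u * (FreeMonoid.of a * FreeMonoid.map (Option.getD · a) (y n))}

/-- There is an ultrafilter `p` on words with the property that any `p`-large set contains a large
set `D` all of whose finite subsets can be extended inside `D` by a left variable word. -/
theorem exists_ultrafilter_extension (A : Type*) [Finite A] [Nonempty A] :
    ∃ p : Ultrafilter (FreeMonoid A), ∀ B ∈ p, ∃ D ⊆ B, D ∈ p ∧
      ∀ F ⊆ D, F.Finite → ∃ y : FreeMonoid (Option A), ∀ v ∈ F, ∀ a : A,
        v * (FreeMonoid.of a * FreeMonoid.map (Option.getD · a) y) ∈ D := by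
  obtain ⟨L, Lc, ⟨l, hl⟩, Lmul, Lid⟩ :=
    exists_closed_leftIdeal_mul_idempotent (M := Ultrafilter (FreeMonoid A))
      Ultrafilter.continuous_mul_left
  let σ (a : A) : FreeMonoid (Option A) →* FreeMonoid A := FreeMonoid.map (Option.getD · a)
  let σ' (a : A) : FreeMonoid (Option A) →ₙ* FreeMonoid A := ⟨σ a, (σ a).map_mul⟩
  -- The variable comes first because block `n` of a rigid surjection must start with its new letter
  -- `n`.
  let V : Set (FreeMonoid (Option A)) := Set.range (FreeMonoid.of none * ·)
  let T : Set (Ultrafilter (FreeMonoid (Option A))) :=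
    {q | V ∈ q} ∩ ⋂ a, Ultrafilter.map (σ' a) ⁻¹' L
  have Tc : IsClosed T := (ultrafilter_isClosed_basic V).inter
    (isClosed_iInter fun a => Lc.preimage (continuous_ultrafilter_map _))
  have Tn : T.Nonempty := by
    -- Putting the variable in front of `l`-random words works: its instance at `a` is `a * l`,
    -- which stays in the left ideal.
    refine ⟨l.map (fun w => FreeMonoid.of none * FreeMonoid.map some w), ?_, ?_⟩
    · exact Filter.Eventually.of_forall fun w => ⟨_, rfl⟩
    · refine Set.mem_iInter.2 fun a => ?_
      have h : (l.map (fun w => FreeMonoid.of none * FreeMonoid.map some w)).map (σ' a)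
          = pure (FreeMonoid.of a) * l := by
        apply Ultrafilter.coe_inj.mp
        refine Filter.ext' fun p => ?_
        rw [Ultrafilter.eventually_mul]
        have h' : ∀ w : FreeMonoid A, σ' a (FreeMonoid.of none * FreeMonoid.map some w)
            = FreeMonoid.of a * w := by
          intro w
          change σ a _ = _
          simp only [map_mul, σ, FreeMonoid.map_of, Option.getD_none, FreeMonoid.map_map]
          congr 1
          exact List.map_id w
        simp only [Ultrafilter.coe_map, Filter.eventually_map, h', Ultrafilter.coe_pure,
          Filter.eventually_pure]
      rw [Set.mem_preimage, h]
      exact Lmul _ _ hl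
  obtain ⟨q, ⟨qV, qL⟩, qq⟩ := exists_idempotent_in_compact_subsemigroup
    Ultrafilter.continuous_mul_left T Tn Tc.isCompact (by
      rintro u ⟨hu, hu'⟩ v ⟨hv, hv'⟩
      refine ⟨?_, Set.mem_iInter.2 fun a => ?_⟩
      · change ∀ᶠ m in (↑(u * v) : Filter _), m ∈ V
        rw [Ultrafilter.eventually_mul]
        filter_upwards [hu] with x hx
        obtain ⟨z, rfl⟩ := hx
        exact Filter.Eventually.of_forall fun t => ⟨z * t, (mul_assoc _ _ _).symm⟩
      · rw [Set.mem_preimage, ultrafilter_map_mul]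
        exact Lmul _ _ (Set.mem_iInter.1 hv' a))
  have qL' : ∀ a, q.map (σ' a) ∈ L := fun a => Set.mem_iInter.1 qL a
  have idem : ∀ a, q.map (σ' a) * q.map (σ' a) = q.map (σ' a) := fun a => by
    rw [← ultrafilter_map_mul, qq]
  -- `D` consists of the words of `B` that `q`-most variable words extend inside `B`; it is
  -- `l`-large because `l * σ a q = l`.
  refine ⟨l, fun B hB => ⟨{w | w ∈ B ∧ ∀ a, ∀ᶠ y in q, w * σ a y ∈ B}, fun w hw => hw.1, ?_, ?_⟩⟩
  · refine Filter.Eventually.and hB (Filter.eventually_all.2 fun a => ?_)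
    have h : ∀ᶠ w in (l : Filter _), w ∈ B := hB
    rw [← Lid _ (qL' a) (idem a) l hl, Ultrafilter.eventually_mul] at h
    exact h
  · intro F hF Ffin
    have key : ∀ᶠ x in q, ∀ v ∈ F, ∀ a, v * σ a x ∈ B ∧ ∀ b, ∀ᶠ y in q, v * σ a x * σ b y ∈ B := by
      refine (Filter.eventually_all_finite Ffin).2 fun v hv => Filter.eventually_all.2 fun a =>
        ((hF hv).2 a).and (Filter.eventually_all.2 fun b => ?_)
      -- The extended word must again lie in `D`, not only in `B`; this uses `σ a q * σ b q = σ a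
      -- q`.
      have h : ∀ᶠ w in (q.map (σ' a) : Filter _), v * w ∈ B := (hF hv).2 a
      rw [← Lid _ (qL' b) (idem b) _ (qL' a), Ultrafilter.eventually_mul] at h
      refine Filter.Eventually.mono (Filter.eventually_map.1 h) fun x hx => ?_
      exact (Filter.eventually_map.1 hx).mono fun y hy => by rw [mul_assoc]; exact hy
    obtain ⟨_, hx, z, rfl⟩ := (key.and qV).exists
    refine ⟨z, fun v hv a => ?_⟩
    simpa [σ] using hx v hv a

/-- The Carlson–Simpson lemma for left variable words. -/
theorem exists_monochromatic_wordExtensions {A κ : Type*} [Finite A] [Nonempty A] [Finite κ]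
    (C : FreeMonoid A → κ) :
    ∃ (w : FreeMonoid A) (y : ℕ → FreeMonoid (Option A)) (c : κ),
      ∀ n, ∀ v ∈ wordExtensions w y n, C v = c := by
  obtain ⟨p, hp⟩ := exists_ultrafilter_extension A
  obtain ⟨c, hc⟩ : ∃ c, ∀ᶠ v in p, C v = c := by
    rw [← Ultrafilter.eventually_exists_iff]
    exact Filter.Eventually.of_forall fun v => ⟨_, rfl⟩
  obtain ⟨D, hDB, hD, hext⟩ := hp _ hc
  obtain ⟨w, hw⟩ := Filter.nonempty_of_mem hD
  choose! Y hY using hext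
  -- The next variable word is chosen for the whole finite set of words built so far.
  let next (F : Set (FreeMonoid A)) : Set (FreeMonoid A) := {v | ∃ u ∈ F, ∃ a : A,
      v = u * (FreeMonoid.of a * FreeMonoid.map (Option.getD · a) (Y F))}
  let G : ℕ → Set (FreeMonoid A) := fun n => next^[n] {w}
  have hG : ∀ n, wordExtensions w (fun n => Y (G n)) n = G n := by
    intro n
    induction n with
    | zero => rfl
    | succ n ih =>
      simp only [wordExtensions, ih, G, Function.iterate_succ_apply', next]
  have hGD : ∀ n, (G n).Finite ∧ G n ⊆ D := by
    intro n
    induction n with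
    | zero => exact ⟨Set.finite_singleton w, Set.singleton_subset_iff.2 hw⟩
    | succ n ih =>
      have h : G (n + 1) = next (G n) := Function.iterate_succ_apply' _ _ _
      rw [h]
      constructor
      · refine ((ih.1.prod (Set.finite_univ (α := A))).image (fun z => z.1 *
          (FreeMonoid.of z.2 * FreeMonoid.map (Option.getD · z.2) (Y (G n))))).subset ?_
        rintro v ⟨u, hu, a, rfl⟩
        exact ⟨(u, a), ⟨hu, trivial⟩, rfl⟩
      · rintro v ⟨u, hu, a, rfl⟩
        exact hY _ ih.2 ih.1 u hu a
  exact ⟨w, fun n => Y (G n), c, fun n v hv => hDB ((hGD n).2 (hG n ▸ hv))⟩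

end LeftVariableWords

/-! ### Substitution into rigid words and fusion -/

section Substitution

/-- `H` is the sequence of the restrictions `h ↾ min h⁻¹(n)` of some `h ∈ RSurj(ω, ω)`, written as
lists. -/
def IsPrefixSeq (H : ℕ → List ℕ) : Prop :=
  H 0 = [] ∧ ∀ n, ∃ u : List ℕ, (∀ x ∈ u, x ≤ n) ∧ H (n + 1) = H n ++ n :: u

/-- The composition of the word `l` with the restriction `H l.length`. -/
def subst (H : ℕ → List ℕ) (l : List ℕ) : List ℕ :=
  (H l.length).map (fun i => l.getD i 0)

/-- The words that are rigid surjections onto `r`. -/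
inductive IsRigidWord : ℕ → List ℕ → Prop
  | nil : IsRigidWord 0 []
  | snoc {r : ℕ} {p u : List ℕ} : IsRigidWord r p → (∀ x ∈ u, x ≤ r) →
      IsRigidWord (r + 1) (p ++ r :: u)

variable {G H : ℕ → List ℕ}

/-- Consequently `subst` never reads its default value `0`. -/
theorem IsPrefixSeq.lt (hH : IsPrefixSeq H) {n x : ℕ} (hx : x ∈ H n) : x < n := by
  induction n with
  | zero => simp [hH.1] at hx
  | succ n ih =>
    obtain ⟨u, hu, h⟩ := hH.2 n
    rw [h, List.mem_append, List.mem_cons] at hx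
    rcases hx with hx | rfl | hx
    · exact (ih hx).trans n.lt_succ_self
    · exact Nat.lt_succ_self _
    · exact Nat.lt_succ_of_le (hu x hx)

theorem subst_nil (hH : IsPrefixSeq H) : subst H [] = [] := by
  simp [subst, hH.1]

theorem map_getD_append (hH : IsPrefixSeq H) (l t : List ℕ) :
    (H l.length).map (fun i => (l ++ t).getD i 0) = subst H l := by
  refine List.map_congr_left fun i hi => ?_
  rw [List.getD_append _ _ _ _ (hH.lt hi)]

theorem subst_concat_eq (hH : IsPrefixSeq H) {l : List ℕ} {u : List ℕ} (a : ℕ)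
    (hu : H (l.length + 1) = H l.length ++ l.length :: u) :
    subst H (l ++ [a]) = subst H l ++ a :: u.map (fun i => (l ++ [a]).getD i 0) := by
  rw [subst, List.length_append, List.length_singleton, hu, List.map_append, map_getD_append hH]
  simp

theorem subst_concat (hH : IsPrefixSeq H) (l : List ℕ) (a : ℕ) :
    ∃ u, (∀ x ∈ u, x ∈ l ++ [a]) ∧ subst H (l ++ [a]) = subst H l ++ a :: u := by
  obtain ⟨u, hu, h⟩ := hH.2 l.length
  refine ⟨_, ?_, subst_concat_eq hH a h⟩
  intro x hx
  obtain ⟨i, hi, rfl⟩ := List.mem_map.1 hx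
  have : i < (l ++ [a]).length := by simpa using Nat.lt_succ_of_le (hu i hi)
  rw [List.getD_eq_getElem _ _ this]
  exact List.getElem_mem this

/-- Each letter appended to a word appends one block to its substitution, starting with that letter
and otherwise repeating letters already present. -/
theorem subst_append (hH : IsPrefixSeq H) (l : List ℕ) (a : ℕ) (t : List ℕ) :
    ∃ u, (∀ x ∈ u, x ∈ l ++ a :: t) ∧ subst H (l ++ a :: t) = subst H l ++ a :: u := by
  induction t using List.reverseRecOn with
  | nil => exact subst_concat hH l a
  | append_singleton t b ih =>
    obtain ⟨u, hu, h⟩ := ih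
    obtain ⟨v, hv, h'⟩ := subst_concat hH (l ++ a :: t) b
    refine ⟨u ++ b :: v, ?_, ?_⟩
    · intro x hx
      rw [List.mem_append, List.mem_cons] at hx
      rw [← List.cons_append, ← List.append_assoc]
      rcases hx with hx | rfl | hx
      · exact List.mem_append_left _ (hu x hx)
      · simp
      · exact hv x hx
    · rw [← List.cons_append, ← List.append_assoc, h', h]
      simp

theorem IsRigidWord.lt {r : ℕ} {l : List ℕ} (h : IsRigidWord r l) : ∀ x ∈ l, x < r := by
  induction h with
  | nil => simp
  | snoc _ hu ih =>
    intro x hx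
    rw [List.mem_append, List.mem_cons] at hx
    rcases hx with hx | rfl | hx
    · exact (ih x hx).trans (Nat.lt_succ_self _)
    · exact Nat.lt_succ_self _
    · exact Nat.lt_succ_of_le (hu x hx)

theorem IsRigidWord.mem {r : ℕ} {l : List ℕ} (h : IsRigidWord r l) : ∀ x < r, x ∈ l := by
  induction h with
  | nil => simp
  | snoc _ hu ih =>
    intro x hx
    rcases Nat.lt_succ_iff_lt_or_eq.1 hx with hx | rfl
    · exact List.mem_append_left _ (ih x hx)
    · simp

/-- Substitution respects the splitting at the first `r`, and the part before it is substituted on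
its own. This lets the induction on `r` and the fusion treat `p` separately. -/
theorem subst_snoc (hH : IsPrefixSeq H) {r : ℕ} {p u : List ℕ} (hp : IsRigidWord r p)
    (hu : ∀ x ∈ u, x ≤ r) :
    ∃ v, (∀ x ∈ v, x ≤ r) ∧ subst H (p ++ r :: u) = subst H p ++ r :: v := by
  obtain ⟨v, hv, h⟩ := subst_append hH p r u
  exact ⟨v, fun x hx => Nat.le_of_lt_succ ((IsRigidWord.snoc hp hu).lt x (hv x hx)), h⟩

theorem IsRigidWord.subst (hH : IsPrefixSeq H) {r : ℕ} {l : List ℕ} (h : IsRigidWord r l) :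
    IsRigidWord r (subst H l) := by
  induction h with
  | nil => rw [subst_nil hH]; exact .nil
  | snoc hp hu ih =>
    obtain ⟨v, hv, h⟩ := subst_snoc hH hp hu
    rw [h]
    exact ih.snoc hv

theorem isPrefixSeq_subst (hH : IsPrefixSeq H) (hG : IsPrefixSeq G) :
    IsPrefixSeq (fun n => subst H (G n)) := by
  refine ⟨by simp [hG.1, subst_nil hH], fun n => ?_⟩
  obtain ⟨u, hu, h⟩ := hG.2 n
  obtain ⟨v, hv, h'⟩ := subst_append hH (G n) n u
  refine ⟨v, fun x hx => ?_, by simp only [h, h']⟩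
  have := hv x hx
  rw [← h] at this
  exact Nat.le_of_lt_succ (hG.lt this)

/-- Associativity: both sides read `l` through `G` and then `H`, and the lengths selecting the
restrictions agree. -/
theorem subst_subst (hH : IsPrefixSeq H) (l : List ℕ) :
    subst (fun n => subst H (G n)) l = subst H (subst G l) := by
  simp only [subst, List.map_map, List.length_map]
  refine List.map_congr_left fun i hi => ?_
  have h : i < (G l.length).length := hH.lt hi
  simp [h]

theorem isPrefixSeq_range : IsPrefixSeq List.range :=
  ⟨rfl, fun n => ⟨[], by simp, List.range_succ⟩⟩

theorem subst_range {l : List ℕ} {m : ℕ} (hG : G m = List.range m) (hl : l.length = m) :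
    subst G l = l := by
  subst hl
  rw [subst, hG]
  refine List.ext_getElem (by simp) fun i h1 h2 => ?_
  simp [h2]

/-- The prefix sequence with given blocks. -/
def ofBlocks (b : ℕ → List ℕ) : ℕ → List ℕ
  | 0 => []
  | n + 1 => ofBlocks b n ++ n :: b n

theorem isPrefixSeq_ofBlocks {b : ℕ → List ℕ} (hb : ∀ n, ∀ x ∈ b n, x ≤ n) :
    IsPrefixSeq (ofBlocks b) :=
  ⟨rfl, fun n => ⟨b n, hb n, rfl⟩⟩

/-- One step of the fusion: the color of the words extending a rigid word of length `m` onto `r` by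
`r` is stabilized. -/
theorem exists_prefixSeq_stabilizing {κ : Type*} [Finite κ] (r m : ℕ) (χ : List ℕ → κ) :
    ∃ G, IsPrefixSeq G ∧ (∀ n ≤ m, G n = List.range n) ∧
      ∀ p, IsRigidWord r p → p.length = m → ∃ c, ∀ u : List ℕ, (∀ x ∈ u, x ≤ r) →
        χ (subst G (p ++ r :: u)) = c := by
  -- `Q` indexes a finite family containing all rigid words of length `m` onto `r`, so one
  -- vector-valued coloring treats them simultaneously.
  let Q := Fin m → Fin (r + 1)
  let q (p : List ℕ) (i : ℕ) : ℕ := (p ++ [r]).getD i 0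
  let W (f : Q) : List ℕ := List.ofFn (fun i => (f i : ℕ))
  obtain ⟨w, y, c, hc⟩ := exists_monochromatic_wordExtensions (A := Fin (m + 1))
    (κ := Q → κ) (fun v f => χ (W f ++ r :: (FreeMonoid.toList v).map (fun i : Fin (m + 1) => q (W f) i)))
  -- Trivial blocks below `m` leave `p` unchanged, block `m` carries `w`, and each later block `n`
  -- carries the next variable word with its variable read as `n`; the leading variable is the `n`
  -- supplied by `ofBlocks`.
  let b (n : ℕ) : List ℕ := if n < m then [] else if n = m then
    (FreeMonoid.toList w).map Fin.val else
    (FreeMonoid.toList (y (n - m - 1))).map (fun o => o.elim n Fin.val)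
  have hb : ∀ n, ∀ x ∈ b n, x ≤ n := by
    intro n x hx
    simp only [b] at hx
    split_ifs at hx with h1 h2
    · simp at hx
    · obtain ⟨i, -, rfl⟩ := List.mem_map.1 hx
      omega
    · obtain ⟨o, -, rfl⟩ := List.mem_map.1 hx
      cases o with
      | none => exact le_rfl
      | some i => simp only [Option.elim]; omega
  have hG := isPrefixSeq_ofBlocks hb
  have hrange : ∀ n ≤ m, ofBlocks b n = List.range n := by
    intro n hn
    induction n with
    | zero => rfl
    | succ n ih =>
      have : b n = [] := if_pos hn
      rw [ofBlocks, ih (by omega), this, List.range_succ]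
  refine ⟨ofBlocks b, hG, hrange, fun p hp hpm => ?_⟩
  obtain ⟨f, hf⟩ : ∃ f : Q, W f = p := by
    refine ⟨fun i => ⟨p.getD i 0, ?_⟩, ?_⟩
    · have : (i : ℕ) < p.length := by omega
      rw [List.getD_eq_getElem _ _ this]
      exact (hp.lt _ (List.getElem_mem _)).trans (Nat.lt_succ_self _)
    · refine List.ext_getElem (by simp [W, hpm]) fun i h1 h2 => ?_
      simp [W, h2]
  have key : ∀ u : List ℕ, (∀ x ∈ u, x ≤ r) → ∃ v ∈ wordExtensions w y u.length,
      subst (ofBlocks b) (p ++ r :: u) =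
        p ++ r :: (FreeMonoid.toList v).map (fun i : Fin (m + 1) => q p i) := by
    intro u
    induction u using List.reverseRecOn with
    | nil =>
      intro _
      refine ⟨w, rfl, ?_⟩
      have hbm : b m = (FreeMonoid.toList w).map Fin.val := by simp [b]
      rw [subst_concat_eq hG r (by rw [hpm]; rfl), subst_range (hrange m le_rfl) hpm, hbm,
        List.map_map]
      rfl
    | append_singleton u a ih =>
      intro hu
      obtain ⟨v, hv, h⟩ := ih fun x hx => hu x (List.mem_append_left _ hx)
      -- Since `p` is onto `r`, the letter `a` has a position in `p ++ [r]`, and that position is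
      -- what replaces the variable.
      have ha : a ∈ p ++ [r] := by
        rcases (hu a (by simp)).lt_or_eq with h | rfl
        · exact List.mem_append_left _ (hp.mem a h)
        · simp
      obtain ⟨i, hi, hia⟩ := List.getElem_of_mem ha
      have hi' : i < m + 1 := by simpa [hpm] using hi
      have hqi : q p i = a := by simp only [q]; rw [List.getD_eq_getElem _ _ hi, hia]
      rw [List.length_append, List.length_singleton]
      refine ⟨_, ⟨v, hv, ⟨i, hi'⟩, rfl⟩, ?_⟩
      have hlen : (p ++ r :: u).length = m + 1 + u.length := by simp [hpm]; omega
      have hbn : b (p ++ r :: u).length = (FreeMonoid.toList (y u.length)).map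
          (fun o => o.elim (p ++ r :: u).length Fin.val) := by
        rw [hlen]
        simp only [b]
        rw [if_neg (by omega), if_neg (by omega)]
        congr 4
        omega
      rw [← List.cons_append, ← List.append_assoc, subst_concat_eq hG a rfl, h, hbn]
      simp only [List.append_assoc, List.cons_append, List.map_map, FreeMonoid.toList_mul,
        FreeMonoid.toList_of, FreeMonoid.toList_map, List.map_append, List.map_cons,
        List.nil_append, hqi]
      congr 4
      refine List.map_congr_left fun o ho => ?_
      cases o with
      | none => simp [hqi]
      | some j =>
        have hj : (j : ℕ) < (p ++ [r]).length := by simp only [List.length_append, hpm]; exact j.isLt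
        have e : p ++ r :: (u ++ [a]) = (p ++ [r]) ++ (u ++ [a]) := by simp
        simp only [Function.comp, Option.elim, Option.getD_some, q]
        rw [e, List.getD_append _ _ _ _ hj]
  refine ⟨c f, fun u hu => ?_⟩
  obtain ⟨v, hv, h⟩ := key u hu
  rw [h, ← hc _ v hv]
  simp only [hf]

/-- Fusion: below some prefix sequence, the color of a rigid word onto `r + 1` depends only on
its part before the first occurrence of `r`. -/
theorem exists_prefixSeq_dependsOn {κ : Type*} [Finite κ] (r : ℕ) (χ : List ℕ → κ) :
    ∃ (H : ℕ → List ℕ) (c : List ℕ → κ), IsPrefixSeq H ∧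
      ∀ p u, IsRigidWord r p → (∀ x ∈ u, x ≤ r) → χ (subst H (p ++ r :: u)) = c p := by
  choose! g hg hrange hstab using fun m => exists_prefixSeq_stabilizing (κ := κ) r m
  -- Stage `m + 1` refines stage `m` by stabilizing prefixes of length `m` for the coloring already
  -- pulled back along `K m`. As the refinement is trivial up to `m`, the diagonal `K n n` is well
  -- behaved.
  let K : ℕ → ℕ → List ℕ := fun m => Nat.rec List.range
    (fun m H n => subst H (g m (fun l => χ (subst H l)) n)) m
  have hK : ∀ m, IsPrefixSeq (K m) := by
    intro m
    induction m with
    | zero => exact isPrefixSeq_range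
    | succ m ih => exact isPrefixSeq_subst ih (hg _ _)
  have hstep : ∀ m j, ∃ G, IsPrefixSeq G ∧ (∀ n ≤ m, G n = List.range n) ∧
      K (m + j) = fun n => subst (K m) (G n) := by
    intro m j
    induction j with
    | zero =>
      refine ⟨_, isPrefixSeq_range, fun _ _ => rfl, funext fun n => ?_⟩
      simp only [Nat.add_zero]
      rw [subst, List.length_range]
      refine (List.map_id _).symm.trans (List.map_congr_left fun i hi => ?_)
      simp [(hK m).lt hi]
    | succ j ih =>
      obtain ⟨G, hG, hGr, h⟩ := ih
      let G' := g (m + j) (fun l => χ (subst (K (m + j)) l))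
      have hG' : ∀ n ≤ m, G' n = List.range n := fun n hn => hrange _ _ n (by omega)
      refine ⟨fun n => subst G (G' n), isPrefixSeq_subst hG (hg _ _), fun n hn => ?_, ?_⟩
      · simp only [hG' n hn]
        rw [subst_range (m := n) (hGr n hn) List.length_range]
      · funext n
        change subst (K (m + j)) (G' n) = _
        rw [h]
        exact subst_subst (hK m) _
  have hagree : ∀ m n, n ≤ m → K m n = K n n := by
    intro m n hn
    obtain ⟨j, rfl⟩ := Nat.exists_eq_add_of_le hn
    obtain ⟨G, hG, hGr, h⟩ := hstep n j
    rw [h]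
    simp only [hGr n le_rfl]
    rw [subst, List.length_range]
    refine (List.map_congr_left fun i hi => ?_).trans (List.map_id _)
    simp [(hK n).lt hi]
  have hsub : ∀ l : List ℕ, ∀ m, l.length ≤ m → subst (fun n => K n n) l = subst (K m) l := by
    intro l m hl
    simp only [subst]
    rw [hagree m _ hl]
  have hc : ∀ p, ∃ c, IsRigidWord r p → ∀ u : List ℕ, (∀ x ∈ u, x ≤ r) →
      χ (subst (K (p.length + 1)) (p ++ r :: u)) = c := by
    intro p
    by_cases hp : IsRigidWord r p
    · obtain ⟨c, hc⟩ := hstab p.length (fun l => χ (subst (K p.length) l)) p hp rfl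
      refine ⟨c, fun _ u hu => ?_⟩
      rw [← hc u hu, ← subst_subst (hK _)]
    -- A dummy color for words that are not rigid.
    · exact ⟨χ [], fun h => absurd h hp⟩
  choose c hc using hc
  refine ⟨fun n => K n n, c, ⟨(hK 0).1, fun n => ?_⟩, fun p u hp hu => ?_⟩
  · change ∃ u : List ℕ, _ ∧ K (n + 1) (n + 1) = K n n ++ n :: u
    rw [← hagree (n + 1) n n.le_succ]
    exact (hK (n + 1)).2 n
  · rw [hsub _ _ le_rfl]
    have hlen : (p ++ r :: u).length = p.length + 1 + u.length := by simp; omega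
    -- All stages after `p.length + 1` fix `p` and only change the tail, to which the stabilized
    -- color is insensitive.
    obtain ⟨G, hG, hGr, h⟩ := hstep (p.length + 1) u.length
    rw [hlen, h]
    obtain ⟨v, hv, h'⟩ := subst_snoc hG hp hu
    rw [subst_subst (G := G) (hK (p.length + 1)), h', subst_range (hGr p.length (Nat.le_succ _)) rfl]
    exact hc p hp v hv

/-- The monochromatic theorem for rigid words. -/
theorem exists_prefixSeq_monochromatic {κ : Type*} [Finite κ] (r : ℕ) (χ : List ℕ → κ) :
    ∃ (H : ℕ → List ℕ) (c : κ), IsPrefixSeq H ∧ ∀ l, IsRigidWord r l → χ (subst H l) = c := by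
  induction r generalizing χ with
  | zero =>
    refine ⟨List.range, χ [], isPrefixSeq_range, fun l hl => ?_⟩
    cases hl
    rfl
  | succ r ih =>
    obtain ⟨H, d, hH, hd⟩ := exists_prefixSeq_dependsOn r χ
    obtain ⟨G, c, hG, hc⟩ := ih d
    refine ⟨fun n => subst H (G n), c, isPrefixSeq_subst hH hG, fun l hl => ?_⟩
    cases hl with
    | snoc hp hu =>
      obtain ⟨v, hv, h⟩ := subst_snoc hG hp hu
      rw [subst_subst hH, h, hd _ _ (hp.subst hG) hv, hc _ hp]

end Substitution

/-! ### From words back to rigid surjections -/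

section Transfer

variable {H : ℕ → List ℕ}

theorem IsPrefixSeq.isPrefix (hH : IsPrefixSeq H) {m n : ℕ} (h : m ≤ n) : H m <+: H n := by
  induction n, h using Nat.le_induction with
  | base => exact List.prefix_refl _
  | succ n _ ih =>
    obtain ⟨u, -, h⟩ := hH.2 n
    rw [h]
    exact ih.trans (List.prefix_append _ _)

theorem IsPrefixSeq.le_length (hH : IsPrefixSeq H) (n : ℕ) : n ≤ (H n).length := by
  induction n with
  | zero => exact Nat.zero_le _
  | succ n ih =>
    obtain ⟨u, -, h⟩ := hH.2 n
    rw [h]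
    simp
    omega

/-- The infinite word with prefixes `H n`. -/
def limitWord (H : ℕ → List ℕ) (j : ℕ) : ℕ := (H (j + 1)).getD j 0

/-- The words `H n` are nested, so any one long enough gives the same letter. -/
theorem limitWord_eq (hH : IsPrefixSeq H) {n j : ℕ} (hj : j < (H n).length) :
    limitWord H j = (H n)[j] := by
  have hj' : j < (H (j + 1)).length := hH.le_length (j + 1)
  rw [limitWord, List.getD_eq_getElem _ _ hj']
  rcases le_total n (j + 1) with h | h
  · exact ((hH.isPrefix h).getElem hj).symm
  · exact (hH.isPrefix h).getElem hj'

theorem limitWord_length (hH : IsPrefixSeq H) (n : ℕ) : limitWord H (H n).length = n := by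
  obtain ⟨u, -, h⟩ := hH.2 n
  rw [limitWord_eq hH (n := n + 1) (by simp [h])]
  simp [h]

theorem limitWord_lt (hH : IsPrefixSeq H) {n j : ℕ} (hj : j < (H n).length) :
    limitWord H j < n := by
  rw [limitWord_eq hH hj]
  exact hH.lt (List.getElem_mem _)

theorem firstPreimage_limitWord (hH : IsPrefixSeq H) (hs : Function.Surjective (limitWord H))
    (n : ℕ) : firstPreimage (limitWord H) hs n = (H n).length := by
  apply le_antisymm
  · have h := firstPreimage_le _ hs (H n).length
    rwa [limitWord_length hH] at h
  · by_contra! h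
    exact (limitWord_lt hH h).ne (apply_firstPreimage _ hs n)

/-- The rigid surjection `ω → ω` with prefixes `H n`. -/
def IsPrefixSeq.toRSurj (hH : IsPrefixSeq H) : RSurj ℕ ℕ where
  toFun := limitWord H
  surjective n := ⟨_, limitWord_length hH n⟩
  rigid := by
    intro b b' hb
    generalize_proofs hs
    rw [firstPreimage_limitWord hH, firstPreimage_limitWord hH]
    obtain ⟨u, -, h⟩ := hH.2 b
    have := (hH.isPrefix (Nat.succ_le_of_lt hb)).length_le
    simp only [Nat.succ_eq_add_one, h, List.length_append, List.length_cons] at this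
    omega

theorem canonical_eq_last_iff (s j : ℕ) : (canonical s).toFun j = Fin.last s ↔ s ≤ j := by
  simp only [canonical]
  split_ifs with h
  · simp only [Fin.ext_iff, Fin.val_last]
    omega
  · simp only [true_iff]
    omega

theorem canonical_val_of_lt {s j : ℕ} (h : j < s) : ((canonical s).toFun j : ℕ) = j := by
  simp only [canonical]
  rw [dif_pos (by omega)]

theorem first_canonical_comp (hH : IsPrefixSeq H) (s : ℕ) :
    ((canonical s).comp hH.toRSurj).first (Fin.last s) = (H s).length := by
  apply le_antisymm
  · have h := ((canonical s).comp hH.toRSurj).first_le (H s).length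
    have h' : ((canonical s).comp hH.toRSurj).toFun (H s).length = Fin.last s := by
      change (canonical s).toFun (limitWord H (H s).length) = _
      rw [canonical_eq_last_iff, limitWord_length hH]
    rwa [h'] at h
  · by_contra! h
    have h' := ((canonical s).comp hH.toRSurj).apply_first (Fin.last s)
    exact ((canonical_eq_last_iff _ _).1 h').not_gt (limitWord_lt hH h)

/-- A rigid surjection between finite ordinals as a word. -/
def FinRSurj.toList {r : ℕ} (g : FinRSurj r) : List ℕ :=
  List.ofFn (fun i => (g.2.toFun i : ℕ))

theorem FinRSurj.toList_injective (r : ℕ) :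
    Function.Injective (FinRSurj.toList : FinRSurj r → List ℕ) := by
  rintro ⟨⟨s, hs⟩, f⟩ ⟨⟨t, ht⟩, g⟩ h
  have hst : s = t := by simpa [FinRSurj.toList] using congrArg List.length h
  subst hst
  have hfg : f.toFun = g.toFun := by
    have := List.ofFn_injective h
    funext i
    exact Fin.ext (congrFun this i)
  cases f
  cases g
  simp only at hfg
  subst hfg
  rfl

/-- `π_{s+1} ∘ h` first takes the value `s` at `(H s).length` and agrees with `h` before it, so its
truncation is the word `H s`. -/
theorem toList_ostar (hH : IsPrefixSeq H) {s r : ℕ} (f : RSurj (Fin s) (Fin r)) :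
    (ostar hH.toRSurj f).toList = subst H (List.ofFn (fun i => (f.toFun i : ℕ))) := by
  have hfirst := first_canonical_comp hH s
  refine List.ext_getElem ?_ fun i h1 h2 => ?_
  · simp [FinRSurj.toList, subst, ostar, phi, hfirst]
  · have hi : i < (H s).length := by simpa [subst] using h2
    have hlt : (H s)[i] < s := hH.lt (List.getElem_mem _)
    have hval : ((canonical s).toFun (limitWord H i) : ℕ) = (H s)[i] := by
      rw [limitWord_eq hH hi, canonical_val_of_lt hlt]
    simp only [FinRSurj.toList, subst, List.getElem_ofFn, List.getElem_map, List.length_ofFn]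
    rw [List.getD_eq_getElem _ _ (by simpa using hlt), List.getElem_ofFn]
    change ((f.toFun _ : Fin r) : ℕ) = _
    congr 2
    exact Fin.ext hval

/-- Split at the first occurrence of `r`: smaller letters first occur earlier, hence in the part
before it, and induction applies there. -/
theorem isRigidWord_of_idxOf_lt (r : ℕ) (l : List ℕ) (hl : ∀ x ∈ l, x < r)
    (hm : ∀ x < r, x ∈ l) (hi : ∀ x y, x < y → y < r → l.idxOf x < l.idxOf y) :
    IsRigidWord r l := by
  induction r generalizing l with
  | zero =>
    rw [List.eq_nil_iff_forall_not_mem.2 fun x hx => absurd (hl x hx) (Nat.not_lt_zero x)]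
    exact .nil
  | succ r ih =>
    obtain ⟨p, u, rfl, hp⟩ := List.eq_append_cons_of_mem (hm r r.lt_succ_self)
    have hr : (p ++ r :: u).idxOf r = p.length := by
      simp [List.idxOf_append_of_notMem hp]
    have hmem : ∀ x < r, x ∈ p := by
      intro x hx
      by_contra h
      have := hi x r hx r.lt_succ_self
      rw [hr, List.idxOf_append_of_notMem h] at this
      omega
    refine IsRigidWord.snoc (ih p ?_ hmem ?_) fun x hx => Nat.le_of_lt_succ (hl x (by simp [hx]))
    · intro x hx
      have h1 := hl x (by simp [hx])
      have h2 : x ≠ r := fun h => hp (h ▸ hx)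
      omega
    · intro x y hxy hy
      have := hi x y hxy (hy.trans r.lt_succ_self)
      rwa [List.idxOf_append_of_mem (hmem x (hxy.trans hy)),
        List.idxOf_append_of_mem (hmem y hy)] at this

theorem idxOf_ofFn {s r : ℕ} (f : RSurj (Fin s) (Fin r)) (b : Fin r) :
    (List.ofFn (fun i => (f.toFun i : ℕ))).idxOf (b : ℕ) = f.first b := by
  have hb : (b : ℕ) ∈ List.ofFn (fun i => (f.toFun i : ℕ)) :=
    (List.mem_ofFn' _ _).2 ⟨f.first b, by simp only [f.apply_first]⟩
  have hlt := List.idxOf_lt_length_of_mem hb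
  have hlt' : (List.ofFn (fun i => (f.toFun i : ℕ))).idxOf (b : ℕ) < s := by simpa using hlt
  apply le_antisymm
  · by_contra! h
    have := List.not_of_lt_findIdx (p := (· == (b : ℕ))) h
    simp [f.apply_first] at this
  · have h := List.getElem_idxOf hlt
    rw [List.getElem_ofFn] at h
    have h' := f.first_le ⟨_, hlt'⟩
    rw [Fin.ext h] at h'
    exact h'

theorem RSurj.isRigidWord {s r : ℕ} (f : RSurj (Fin s) (Fin r)) :
    IsRigidWord r (List.ofFn (fun i => (f.toFun i : ℕ))) := by
  refine isRigidWord_of_idxOf_lt r _ ?_ ?_ ?_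
  · intro x hx
    obtain ⟨i, rfl⟩ := (List.mem_ofFn' _ _).1 hx
    exact (f.toFun i).isLt
  · intro x hx
    exact (List.mem_ofFn' _ _).2 ⟨f.first ⟨x, hx⟩, by simp only [f.apply_first]⟩
  · intro x y hxy hy
    have h := f.first_lt_first (b := ⟨x, hxy.trans hy⟩) (b' := ⟨y, hy⟩) hxy
    have hx' := idxOf_ofFn f ⟨x, hxy.trans hy⟩
    have hy' := idxOf_ofFn f ⟨y, hy⟩
    simp only at hx' hy'
    rw [hx', hy']
    exact h

/-- The identity as a rigid surjection. -/
def RSurj.id (A : Type*) [LinearOrder A] [WellFoundedLT A] : RSurj A A where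
  toFun a := a
  surjective a := ⟨a, rfl⟩
  rigid := by
    intro b b' hb
    generalize_proofs hs
    have h := apply_firstPreimage (fun a : A => a) hs
    rw [h, h]
    exact hb

end Transfer

end DualRamsey

theorem mainTheorem12 (r k : ℕ) (χ : DualRamsey.FinRSurj r → Fin k) :
    ∃ h : DualRamsey.RSurj ℕ ℕ,
      (χ '' ⋃ s : ℕ, ⋃ _ : r ≤ s,
        {g | ∃ f : DualRamsey.RSurj (Fin s) (Fin r), DualRamsey.ostar h f = g}).encard = 1 := by
  open DualRamsey in
  -- The coloring is carried over to all lists, with the extra color `none` off the image of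
  -- `FinRSurj.toList`.
  obtain ⟨H, c, hH, hc⟩ := exists_prefixSeq_monochromatic r
    (Function.extend FinRSurj.toList (fun g => some (χ g)) (fun _ => none))
  have hχ : ∀ (s : ℕ) (f : RSurj (Fin s) (Fin r)), some (χ (ostar hH.toRSurj f)) = c := by
    intro s f
    rw [← hc _ f.isRigidWord, ← toList_ostar hH f, (FinRSurj.toList_injective r).extend_apply]
  -- The identity of `r` shows that the set of colors is nonempty.
  refine ⟨hH.toRSurj, Set.encard_eq_one.2 ⟨χ (ostar hH.toRSurj (RSurj.id (Fin r))), ?_⟩⟩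
  refine Set.eq_singleton_iff_unique_mem.2 ⟨⟨_, ?_, rfl⟩, ?_⟩
  · simp only [Set.mem_iUnion]
    exact ⟨r, le_rfl, _, rfl⟩
  · rintro _ ⟨g, hg, rfl⟩
    simp only [Set.mem_iUnion] at hg
    obtain ⟨s, -, f, rfl⟩ := hg
    exact Option.some_injective _ ((hχ s f).trans (hχ r _).symm)
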